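/- Let $K$ and $M$ be integers with $2\le M\le K$. Let $\mathbb F_q$ be a finite field and $\mathbb F_{q^l}$ an extension of degree $l\ge 1$. A server stores messages $\mathbf X_1,\dots,\mathbf X_K$, independent and uniform on $\mathbb F_{q^l}$, each of entropy $L=l\log_2 q$. Let $\mathbf S$ be uniform among the $M$-subsets of $\{1,\dots,K\}$, let $\mathbf C=(\mathbf c_1,\dots,\mathbf c_M)$ be uniform on $(\mathbb F_q\setminus\{0\})^M$ and independent of $\mathbf S$, let $\mathbf W$ (the demand index) be uniform on $\mathbf S$ given $(\mathbf S,\mathbf C)$, and let $(\mathbf W,\mathbf S,\mathbf C)$ be independent of the messages. A user knows $\mathbf W,\mathbf S,\mathbf C$ and the side information $\mathbf Y=\sum_{j=1}^M \mathbf c_j\mathbf X_{i_j}$, where $\mathbf S=\{i_1<\dots<i_M\}$. In a protocol, the user sends a discrete query $\mathbf Q$, a stochastic function of $(\mathbf W,\mathbf S,\mathbf C)$ whose randomness is independent of the messages, and the server sends an answer $\mathbf A$, a deterministic function of $\mathbf Q$ and $\mathbf X_1,\dots,\mathbf X_K$. A PIR-PCSI–II protocol is a protocol for which $(\mathbf W,\mathbf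 S)$ is independent of $\mathbf Q$ (privacy) and $H(\mathbf X_{\mathbf W}\mid \mathbf A,\mathbf Q,\mathbf Y,\mathbf W,\mathbf S,\mathbf C)=0$ (recoverability). Its rate is $L/H(\mathbf A)$. It is scalar-linear if the answer to each query is a finite list of linear combinations of the messages with coefficients in $\mathbb F_q$ determined by the query. The capacity (respectively, the scalar-linear capacity) is the supremum of the rates of all (respectively, all scalar-linear) PIR-PCSI–II protocols with the given $K$ and $M$, over all prime powers $q$ and all $l\ge 1$. The capacity equals $(K-M+1)^{-1}$ if $\frac{K+1}{2}<M\le K$, and it is at least $(K-M+1)^{-1}$ if $2\le M\le\frac{K+1}{2}$. Moreover, the scalar-linear capacity equals $(K-M+1)^{-1}$ for all $2\le M\le K$. -/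

import Mathlib

open scoped ENNReal

noncomputable section

namespace PIR

/-! ### Discrete probability and Shannon entropy (in bits) -/

/-- Shannon entropy in bits of a probability mass function. The value may be infinite. -/
def entropy {α : Type*} (p : α → ℝ≥0∞) : ℝ≥0∞ :=
  ∑' a, ENNReal.ofReal (Real.negMulLog (p a).toReal / Real.log 2)

/-- The elementary conditional probability `ℙ(U = u | V = v)`
(only meaningful when `ℙ(V = v)` is positive). -/
def condProb {Ω α β : Type*} (μ : PMF Ω) (U : Ω → α) (V : Ω → β) (u : α) (v : β) : ℝ≥0∞ :=
  μ.map (fun ω => (U ω, V ω)) (u, v) / μ.map V v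

/-- Conditional Shannon entropy `H(U | V) = ∑ v, ℙ(V = v) * H(U | V = v)`, in bits. -/
def condEntropy {Ω α β : Type*} (μ : PMF Ω) (U : Ω → α) (V : Ω → β) : ℝ≥0∞ :=
  ∑' v, μ.map V v * entropy (fun u => condProb μ U V u v)

/-! ### The setting -/

/-- The `M`-subsets of the set of message indices. -/
abbrev SupportSet (K M : ℕ) : Type := {S : Finset (Fin K) // S.card = M}

/-- The length-`M` sequences of nonzero elements of the base field. -/
abbrev Coeffs (M : ℕ) (F : Type) [Field F] : Type := Fin M → Fˣ

/-- The scalar-linear combination of the messages with coefficients `g` in the base field. -/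
def linComb {K : ℕ} {F E : Type} [Field F] [Field E] [Algebra F E]
    (g : Fin K → F) (X : Fin K → E) : E :=
  ∑ i, g i • X i

/-- The coded side information `∑ c_{i_j} X_{i_j}`, where `i_1 < ... < i_M` are the elements
of the support set. -/
def sideInfo {K M : ℕ} {F E : Type} [Field F] [Field E] [Algebra F E]
    (S : SupportSet K M) (C : Coeffs M F) (X : Fin K → E) : E :=
  ∑ j : Fin M, (C j : F) • X (S.1.orderEmbOfFin S.2 j)

/-- A query/answer protocol, for `K` messages in the extension `E` of the base field `F` and
side information support size `M`. The query is a stochastic function of the demand index,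
the support set and the coefficients; the answer is a deterministic function of the query and
the messages. The demand always lies in the support set in the model considered here, so the
indicator of this event is a constant and is not displayed as an argument; likewise the
conditioning on it is void. -/
structure Protocol (K M : ℕ) (F E : Type) [Field F] where
  /-- the alphabet of the queries -/
  Query : Type
  /-- the alphabet of the answers -/
  Answer : Type
  /-- the conditional law of the query -/
  query : Fin K → SupportSet K M → Coeffs M F → PMF Query
  /-- the answer of the server -/
  answer : Query → (Fin K → E) → Answer

/-- A joint realization of the random variables of the problem: demand index, support set,
coefficients, messages and query. -/
structure Outcome (K M : ℕ) (F E Q : Type) [Field F] where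
  /-- the demand index -/
  W : Fin K
  /-- the side information support index set -/
  S : SupportSet K M
  /-- the side information coefficients -/
  C : Coeffs M F
  /-- the messages -/
  X : Fin K → E
  /-- the query -/
  Q : Q

theorem supportSet_nonempty {K M : ℕ} (hMK : M ≤ K) : Nonempty (SupportSet K M) := by
  obtain ⟨S, -, hS⟩ := Finset.exists_subset_card_eq
    (s := (Finset.univ : Finset (Fin K))) (n := M) (by simpa using hMK)
  exact ⟨⟨S, hS⟩⟩

theorem SupportSet.nonempty {K M : ℕ} (hM : 1 ≤ M) (S : SupportSet K M) : S.1.Nonempty := by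
  rw [← Finset.card_pos, S.2]
  exact hM

namespace Protocol

variable {K M : ℕ} {F E : Type} [Field F] [Fintype F] [DecidableEq F] [Field E] [Fintype E]
  [Algebra F E]

/-- The joint law of demand index, support set, coefficients, messages and query, when the
demand lies in the support set: the support set and the coefficients are independent and
uniform, the demand index is uniform on the support set given the latter, the messages are
independent and uniform and independent of these, and the query is generated by the protocol
independently of the messages. -/
def law (P : Protocol K M F E) (hM : 1 ≤ M) (hMK : M ≤ K) : PMF (Outcome K M F E P.Query) :=
  haveI : Nonempty (SupportSet K M) := supportSet_nonempty hMK
  (PMF.uniformOfFintype (SupportSet K M)).bind fun S =>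
  (PMF.uniformOfFintype (Coeffs M F)).bind fun C =>
  (PMF.uniformOfFinset S.1 (S.nonempty hM)).bind fun W =>
  (PMF.uniformOfFintype (Fin K → E)).bind fun X =>
  (P.query W S C).map fun Q => ⟨W, S, C, X, Q⟩

/-- The privacy condition on demand index and support set: they are jointly independent of
the query, i.e. their posterior law given any possible query is their prior law. -/
def IsPrivate (P : Protocol K M F E) (hM : 1 ≤ M) (hMK : M ≤ K) : Prop :=
  ∀ q ∈ ((P.law hM hMK).map fun ω => ω.Q).support, ∀ (W : Fin K) (S : SupportSet K M),
    condProb (P.law hM hMK) (fun ω => (ω.W, ω.S)) (fun ω => ω.Q) (W, S) q =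
      (P.law hM hMK).map (fun ω => (ω.W, ω.S)) (W, S)

/-- The recoverability condition: the demanded message has conditional entropy zero given the
answer, the query, the side information, the demand index, the support set and the
coefficients. -/
def IsRecoverable (P : Protocol K M F E) (hM : 1 ≤ M) (hMK : M ≤ K) : Prop :=
  condEntropy (P.law hM hMK) (fun ω => ω.X ω.W)
    (fun ω => (P.answer ω.Q ω.X, ω.Q, sideInfo ω.S ω.C ω.X, ω.W, ω.S, ω.C)) = 0

/-- A protocol is scalar-linear if the answer to every query consists of scalar-linear
combinations of the messages, with coefficients in the base field determined by the query.
(The answer alphabet may carry other names for these lists of elements of `E`.) -/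
def IsScalarLinear (P : Protocol K M F E) : Prop :=
  ∃ e : P.Answer ↪ List E, ∀ q : P.Query, ∃ G : List (Fin K → F), ∀ X : Fin K → E,
    e (P.answer q X) = G.map fun g => linComb g X

/-- The rate of a protocol: the entropy `l * log₂ q` of a message, where `q` is the size of
the base field and `l` is the degree of the extension, divided by the entropy of the answer. -/
def rate (P : Protocol K M F E) (hM : 1 ≤ M) (hMK : M ≤ K) : ℝ≥0∞ :=
  ENNReal.ofReal (Module.finrank F E * Real.logb 2 (Fintype.card F)) /
    entropy ((P.law hM hMK).map fun ω => P.answer ω.Q ω.X)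

end Protocol

/-- The capacity: the supremum of the rates of all private and recoverable protocols, over all
finite base fields and all finite extensions. -/
def capacity (K M : ℕ) (hM : 1 ≤ M) (hMK : M ≤ K) : ℝ≥0∞ :=
  sSup {r | ∃ (F E : Type) (_ : Field F) (_ : Fintype F) (_ : DecidableEq F) (_ : Field E)
    (_ : Fintype E) (_ : Algebra F E) (P : Protocol K M F E),
    P.IsPrivate hM hMK ∧ P.IsRecoverable hM hMK ∧ r = P.rate hM hMK}

/-- The scalar-linear capacity: the supremum of the rates of all private and recoverable
scalar-linear protocols, over all finite base fields and all finite extensions. -/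
def scalarLinearCapacity (K M : ℕ) (hM : 1 ≤ M) (hMK : M ≤ K) : ℝ≥0∞ :=
  sSup {r | ∃ (F E : Type) (_ : Field F) (_ : Fintype F) (_ : DecidableEq F) (_ : Field E)
    (_ : Fintype E) (_ : Algebra F E) (P : Protocol K M F E), P.IsScalarLinear ∧
    P.IsPrivate hM hMK ∧ P.IsRecoverable hM hMK ∧ r = P.rate hM hMK}

end PIR

end

noncomputable section

namespace PIR

/-! ### Entropy -/

/-! Converse. Privacy makes every possible query serve every pair `(W, S)` with `W ∈ S`: for some
coefficients, the answer and the side information determine the demand (`exists_coeffs_decodable`).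
Suppose that, for each possible query, the answer and `M - 1` further elements of `E` determine all
messages. Then each answer has at most `|E| ^ (M - 1)` preimages, hence probability at most `|E| ^
(-(K - M + 1))`, so `H(A) ≥ (K - M + 1) L` (`rate_le_of_determines`). Such elements are found in two
ways. For `K + 2 ≤ 2 * M` they are side informations of suitably overlapping supports and some
messages (`rate_le_of_two_mul_le`). For scalar-linear answers they are the messages indexed by a
coordinate set `J` complementing the row space `V`. If `J` contained a support of size `M ≥ 2`,
recoverability would put a nonzero vector supported in `J` into `V` (`rate_le_of_isScalarLinear`).
Achievability. The answer applies a Reed-Solomon generator matrix of dimension `K - M + 1` with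
random column multipliers. The code has a word with support `S`, and the multipliers make it equal
the side information coefficients except for a flipped sign at `W`. Subtracting from the side
information leaves `2 c_W X_W`, which yields the demand in odd characteristic. Uniform coefficients
make the multipliers uniform whatever `(W, S)` is, which gives privacy. -/

theorem ofReal_logb_le_entropy {α : Type*} (p : PMF α) {N : ℝ}
    (h : ∀ a, (p a).toReal ≤ N⁻¹) : ENNReal.ofReal (Real.logb 2 N) ≤ entropy p := by
  have h2 : 0 < Real.log 2 := Real.log_pos one_lt_two
  calc ENNReal.ofReal (Real.logb 2 N) = ∑' a, p a * ENNReal.ofReal (Real.logb 2 N) := by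
        rw [ENNReal.tsum_mul_right, p.tsum_coe, one_mul]
    _ ≤ entropy p := by
      refine ENNReal.tsum_le_tsum fun a => ?_
      rw [← ENNReal.ofReal_toReal (p.apply_ne_top a), ← ENNReal.ofReal_mul ENNReal.toReal_nonneg,
        ENNReal.toReal_ofReal ENNReal.toReal_nonneg]
      apply ENNReal.ofReal_le_ofReal
      rw [Real.negMulLog, Real.logb, ← mul_div_assoc]
      refine div_le_div_of_nonneg_right ?_ h2.le
      rcases ENNReal.toReal_nonneg.eq_or_lt with h0 | h0
      · rw [← h0]; simp
      · have := Real.log_le_log h0 (h a)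
        rw [Real.log_inv] at this
        nlinarith

theorem entropy_le_ofReal_logb_card {α : Type*} [Fintype α] [Nonempty α] (p : PMF α) :
    entropy p ≤ ENNReal.ofReal (Real.logb 2 (Fintype.card α)) := by
  have h2 : 0 < Real.log 2 := Real.log_pos one_lt_two
  have hN : (0 : ℝ) < Fintype.card α := by exact_mod_cast Fintype.card_pos
  have hs : ∑ a, (p a).toReal = 1 := by
    rw [← ENNReal.toReal_sum fun a _ => p.apply_ne_top a, ← tsum_fintype (L := .unconditional _),
      p.tsum_coe, ENNReal.toReal_one]
  have hle : ∀ a, (p a).toReal ≤ 1 := fun a =>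
    ENNReal.toReal_le_of_le_ofReal zero_le_one (by simpa using p.coe_le_one a)
  rw [entropy, tsum_fintype, ← ENNReal.ofReal_sum_of_nonneg fun a _ =>
    div_nonneg (Real.negMulLog_nonneg ENNReal.toReal_nonneg (hle a)) h2.le]
  apply ENNReal.ofReal_le_ofReal
  rw [← Finset.sum_div, Real.logb]
  refine div_le_div_of_nonneg_right ?_ h2.le
  -- Gibbs' inequality termwise: `log t ≤ t - 1` at `t = 1 / (N * p a)` with `N` the cardinality.
  -- The correction terms sum to zero.
  have key : ∀ a, Real.negMulLog (p a).toReal ≤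
      (p a).toReal * Real.log (Fintype.card α) + ((Fintype.card α : ℝ)⁻¹ - (p a).toReal) := by
    intro a
    rcases (ENNReal.toReal_nonneg (a := p a)).eq_or_lt with h0 | h0
    · rw [← h0]; simp
    · have := Real.log_le_sub_one_of_pos (inv_pos.2 (mul_pos h0 hN))
      rw [Real.log_inv, Real.log_mul h0.ne' hN.ne'] at this
      have h3 := mul_le_mul_of_nonneg_left this h0.le
      have h4 : (p a).toReal * (((p a).toReal * (Fintype.card α : ℝ))⁻¹ - 1) =
          (Fintype.card α : ℝ)⁻¹ - (p a).toReal := by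
        field_simp
      rw [h4] at h3
      rw [Real.negMulLog]
      linarith
  refine (Finset.sum_le_sum fun a _ => key a).trans (le_of_eq ?_)
  rw [Finset.sum_add_distrib, ← Finset.sum_mul, hs, Finset.sum_sub_distrib, hs]
  simp [hN.ne']

theorem map_pair_add_map_pair_le {Ω α β : Type*} (μ : PMF Ω) (U : Ω → α) (V : Ω → β) {u u' : α}
    (h : u ≠ u') (v : β) :
    μ.map (fun ω => (U ω, V ω)) (u, v) + μ.map (fun ω => (U ω, V ω)) (u', v) ≤ μ.map V v := by
  classical
  rw [PMF.map_apply, PMF.map_apply, PMF.map_apply, ← ENNReal.tsum_add]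
  refine ENNReal.tsum_le_tsum fun ω => ?_
  by_cases hv : v = V ω
  · by_cases hu : u = U ω
    · simp [hv, ← hu, h.symm]
    · simp only [Prod.mk.injEq, hu, hv, and_true, if_false, zero_add, if_true]
      split_ifs <;> simp
  · simp [hv]

theorem map_apply_ne_zero {Ω β : Type*} (μ : PMF Ω) (V : Ω → β) {ω : Ω} (h : ω ∈ μ.support) :
    μ.map V (V ω) ≠ 0 := by
  rw [← PMF.mem_support_iff, PMF.mem_support_map_iff]
  exact ⟨ω, h, rfl⟩

/-- The conditional entropy vanishes if and only if the first variable is determined by the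
second one on the support. -/
theorem condEntropy_eq_zero_iff {Ω α β : Type*} (μ : PMF Ω) (U : Ω → α) (V : Ω → β) :
    condEntropy μ U V = 0 ↔
      ∀ ω ∈ μ.support, ∀ ω' ∈ μ.support, V ω = V ω' → U ω = U ω' := by
  have h2 : 0 < Real.log 2 := Real.log_pos one_lt_two
  constructor
  · intro h ω hω ω' hω' hV
    by_contra hU
    rw [condEntropy, ENNReal.tsum_eq_zero] at h
    have hv := map_apply_ne_zero μ V hω
    have hvt := (μ.map V).apply_ne_top (V ω)
    have h1 := (mul_eq_zero.1 (h (V ω))).resolve_left hv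
    rw [entropy, ENNReal.tsum_eq_zero] at h1
    have h3 := h1 (U ω)
    rw [ENNReal.ofReal_eq_zero] at h3
    have hle := map_pair_add_map_pair_le μ U V hU (V ω)
    have hp : μ.map (fun ω => (U ω, V ω)) (U ω, V ω) ≠ 0 :=
      map_apply_ne_zero μ (fun ω => (U ω, V ω)) hω
    have hp' : μ.map (fun ω => (U ω, V ω)) (U ω', V ω) ≠ 0 := by
      have := map_apply_ne_zero μ (fun ω => (U ω, V ω)) hω'
      rwa [← hV] at this
    -- The competing value `U ω'` has positive mass as well, so the conditional probability lies
    -- strictly between 0 and 1, where `negMulLog` is positive.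
    have hlt : μ.map (fun ω => (U ω, V ω)) (U ω, V ω) < μ.map V (V ω) :=
      (ENNReal.lt_add_right (PMF.apply_ne_top _ _) hp').trans_le hle
    have hc1 : condProb μ U V (U ω) (V ω) < 1 := by
      rw [condProb, ENNReal.div_lt_iff (Or.inl hv) (Or.inl hvt), one_mul]
      exact hlt
    have hc0 : 0 < condProb μ U V (U ω) (V ω) := ENNReal.div_pos hp hvt
    have hr0 : 0 < (condProb μ U V (U ω) (V ω)).toReal :=
      ENNReal.toReal_pos hc0.ne' (hc1.trans ENNReal.one_lt_top).ne
    have hr1 : (condProb μ U V (U ω) (V ω)).toReal < 1 := by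
      rw [← ENNReal.toReal_one]
      exact (ENNReal.toReal_lt_toReal (hc1.trans ENNReal.one_lt_top).ne ENNReal.one_ne_top).2 hc1
    have hpos : 0 < Real.negMulLog (condProb μ U V (U ω) (V ω)).toReal := by
      rw [Real.negMulLog]
      nlinarith [Real.log_neg hr0 hr1]
    exact absurd h3 (not_le.2 (div_pos hpos h2))
  · intro h
    classical
    rw [condEntropy, ENNReal.tsum_eq_zero]
    intro v
    by_cases hv : μ.map V v = 0
    · rw [hv, zero_mul]
    refine mul_eq_zero_of_right _ ?_
    obtain ⟨ω, hω, rfl⟩ := (PMF.mem_support_map_iff V μ v).1 ((PMF.mem_support_iff _ _).2 hv)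
    rw [entropy, ENNReal.tsum_eq_zero]
    intro u
    by_cases hu : u = U ω
    · have : condProb μ U V u (V ω) = 1 := by
        rw [condProb]
        convert ENNReal.div_self hv ((μ.map V).apply_ne_top _) using 2
        rw [PMF.map_apply, PMF.map_apply]
        refine tsum_congr fun ω' => ?_
        by_cases h' : ω' ∈ μ.support
        · by_cases hV : V ω = V ω'
          · simp [hV, hu, h ω hω ω' h' hV]
          · simp [hV]
        · rw [PMF.mem_support_iff, not_not] at h'
          simp [h']
      simp [this]
    · have : condProb μ U V u (V ω) = 0 := by
        rw [condProb, ENNReal.div_eq_zero_iff]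
        left
        by_contra h0
        obtain ⟨ω', hω', he⟩ :=
          (PMF.mem_support_map_iff _ μ _).1 ((PMF.mem_support_iff _ _).2 h0)
        rw [Prod.mk.injEq] at he
        exact hu (he.1.symm.trans (h ω' hω' ω hω he.2))
      simp [this]

/-! ### Probability mass functions -/

theorem bind_apply_le {α β : Type*} (p : PMF α) (f : α → PMF β) (b : β) {c : ℝ≥0∞}
    (h : ∀ a ∈ p.support, f a b ≤ c) : p.bind f b ≤ c := by
  rw [PMF.bind_apply]
  calc ∑' a, p a * f a b ≤ ∑' a, p a * c := by
        refine ENNReal.tsum_le_tsum fun a => ?_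
        by_cases ha : a ∈ p.support
        · gcongr
          exact h a ha
        · rw [PMF.mem_support_iff, not_not] at ha
          simp [ha]
    _ = c := by rw [ENNReal.tsum_mul_right, p.tsum_coe, one_mul]

theorem uniformOfFintype_map_apply {α β : Type*} [Fintype α] [Nonempty α] [DecidableEq β]
    (f : α → β) (b : β) :
    (PMF.uniformOfFintype α).map f b =
      (Finset.univ.filter fun a => f a = b).card * (Fintype.card α : ℝ≥0∞)⁻¹ := by
  rw [PMF.map_apply, tsum_fintype]
  simp only [PMF.uniformOfFintype_apply]
  rw [← Finset.sum_filter, Finset.sum_const, nsmul_eq_mul]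
  congr 3
  ext a
  simp [eq_comm]

theorem bind_map_mk_apply {α β : Type*} (p : PMF α) (ν : PMF β) (a : α) (b : β) :
    (p.bind fun a => ν.map (Prod.mk a)) (a, b) = p a * ν b := by
  classical
  rw [PMF.bind_apply, tsum_eq_single a]
  · congr 1
    rw [PMF.map_apply, tsum_eq_single b]
    · simp
    · intro b' hb
      simp [hb.symm]
  · intro a' ha
    rw [PMF.map_apply]
    simp [ha.symm]

/-- A bijection from a product carries independent uniform variables to a uniform one. -/
theorem uniformOfFintype_bind_map_equiv {α β γ : Type*} [Fintype α] [Nonempty α] [Fintype β]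
    [Nonempty β] [Fintype γ] [Nonempty γ] (e : α × β ≃ γ) :
    (PMF.uniformOfFintype α).bind (fun a => (PMF.uniformOfFintype β).map fun b => e (a, b)) =
      PMF.uniformOfFintype γ := by
  classical
  ext c
  obtain ⟨⟨a, b⟩, rfl⟩ := e.surjective c
  rw [PMF.bind_apply, tsum_eq_single a]
  · have hfib : (Finset.univ.filter fun b' => e (a, b') = e (a, b)) = {b} := by
      ext b'
      simp
    rw [uniformOfFintype_map_apply, hfib, PMF.uniformOfFintype_apply, PMF.uniformOfFintype_apply,
      ← Fintype.card_congr e, Fintype.card_prod, Nat.cast_mul, ENNReal.mul_inv (by simp) (by simp)]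
    simp
  · intro a' ha
    rw [uniformOfFintype_map_apply]
    simp [ha]

/-! ### The law of a protocol -/

theorem finrank_mul_logb_card (F E : Type) [Field F] [Fintype F] [Field E]
    [Fintype E] [Algebra F E] :
    (Module.finrank F E : ℝ) * Real.logb 2 (Fintype.card F) = Real.logb 2 (Fintype.card E) := by
  rw [Module.card_eq_pow_finrank (K := F) (V := E), Nat.cast_pow, Real.logb_pow]

namespace Protocol

variable {K M : ℕ} {F E : Type} [Field F] [Fintype F] [DecidableEq F] [Field E] [Fintype E]

theorem mem_support_law (P : Protocol K M F E) (hM : 1 ≤ M) (hMK : M ≤ K)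
    (ω : Outcome K M F E P.Query) :
    ω ∈ (P.law hM hMK).support ↔ ω.W ∈ ω.S.1 ∧ ω.Q ∈ (P.query ω.W ω.S ω.C).support := by
  have : Nonempty (SupportSet K M) := supportSet_nonempty hMK
  simp only [law, PMF.mem_support_bind_iff, PMF.mem_support_map_iff,
    PMF.support_uniformOfFintype, PMF.mem_support_uniformOfFinset_iff, Set.top_eq_univ,
    Set.mem_univ, true_and]
  constructor
  · rintro ⟨S, C, W, hW, X, Q, hQ, rfl⟩
    exact ⟨hW, hQ⟩
  · rintro ⟨hW, hQ⟩
    exact ⟨ω.S, ω.C, ω.W, hW, ω.X, ω.Q, hQ, rfl⟩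

/-- If the query, averaged over the coefficients, has the same law for all demand indices and
support sets, then the protocol is private. -/
theorem isPrivate_of_bind_query_eq (P : Protocol K M F E) (hM : 1 ≤ M) (hMK : M ≤ K)
    (ν : PMF P.Query)
    (h : ∀ W S, (PMF.uniformOfFintype (Coeffs M F)).bind (P.query W S) = ν) :
    P.IsPrivate hM hMK := by
  have : Nonempty (SupportSet K M) := supportSet_nonempty hMK
  obtain ⟨p, hp⟩ : ∃ p : PMF (Fin K × SupportSet K M),
      p = (PMF.uniformOfFintype (SupportSet K M)).bind fun S =>
        (PMF.uniformOfFinset S.1 (S.nonempty hM)).map fun W => (W, S) := ⟨_, rfl⟩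
  -- Exchanging the draws of `W` and `C` averages the query over the coefficients, so the joint law
  -- is a product.
  have hjoint : (P.law hM hMK).map (fun ω => ((ω.W, ω.S), ω.Q)) =
      p.bind fun a => ν.map (Prod.mk a) := by
    rw [law, hp]
    simp only [PMF.map_bind, PMF.map_comp, PMF.bind_bind, PMF.bind_map, Function.comp_def,
      PMF.bind_const]
    congr 1
    funext S
    rw [PMF.bind_comm]
    congr 1
    funext W
    rw [← h W S, PMF.map_bind]
  have hQ : (P.law hM hMK).map (fun ω => ω.Q) = ν := by
    have h1 := congrArg (PMF.map Prod.snd) hjoint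
    rw [PMF.map_comp] at h1
    refine Eq.trans ?_ (h1.trans ?_)
    · rfl
    · simp only [PMF.map_bind, PMF.map_comp, Function.comp_def, PMF.bind_const]
      exact PMF.map_id ν
  have hWS : (P.law hM hMK).map (fun ω => (ω.W, ω.S)) = p := by
    have h1 := congrArg (PMF.map Prod.fst) hjoint
    rw [PMF.map_comp] at h1
    refine Eq.trans ?_ (h1.trans ?_)
    · rfl
    · simp only [PMF.map_bind, PMF.map_comp, Function.comp_def]
      exact (congrArg p.bind (funext fun a => PMF.map_const ν a)).trans (PMF.bind_pure p)
  intro q hq W S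
  rw [hQ, PMF.mem_support_iff] at hq
  rw [condProb, hjoint, hQ, hWS, bind_map_mk_apply,
    ENNReal.mul_div_cancel_right hq (ν.apply_ne_top q)]

variable [Algebra F E]

/-- For every possible query and every demand index in every support set, there are
coefficients for which the demand can be recovered from that query. -/
theorem exists_coeffs_decodable {P : Protocol K M F E} {hM : 1 ≤ M} {hMK : M ≤ K}
    (hp : P.IsPrivate hM hMK) (hr : P.IsRecoverable hM hMK) {q : P.Query}
    (hq : q ∈ ((P.law hM hMK).map fun ω => ω.Q).support) {W : Fin K} {S : SupportSet K M}
    (hW : W ∈ S.1) :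
    ∃ C : Coeffs M F, ∀ X X' : Fin K → E, P.answer q X = P.answer q X' →
      sideInfo S C X = sideInfo S C X' → X W = X' W := by
  have hprior : (P.law hM hMK).map (fun ω => (ω.W, ω.S)) (W, S) ≠ 0 := by
    obtain ⟨Q, hQ⟩ := (P.query W S 1).support_nonempty
    exact map_apply_ne_zero (P.law hM hMK) (fun ω => (ω.W, ω.S)) (ω := ⟨W, S, 1, 0, Q⟩)
      ((mem_support_law P hM hMK _).2 ⟨hW, hQ⟩)
  -- By privacy the posterior of `(W, S)` given `q` is positive like the prior, so some outcome
  -- realizes all three; its coefficients are the ones sought.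
  rw [← hp q hq W S, condProb, Ne, ENNReal.div_eq_zero_iff, not_or, ← Ne,
    ← PMF.mem_support_iff, PMF.mem_support_map_iff] at hprior
  obtain ⟨⟨ω, hω, he⟩, -⟩ := hprior
  simp only [Prod.mk.injEq] at he
  obtain ⟨⟨rfl, rfl⟩, rfl⟩ := he
  rw [mem_support_law] at hω
  rw [IsRecoverable, condEntropy_eq_zero_iff] at hr
  refine ⟨ω.C, fun X X' hA hY => ?_⟩
  -- The support of the law does not constrain the messages, so they may be replaced freely.
  refine hr ⟨ω.W, ω.S, ω.C, X, ω.Q⟩ ?_ ⟨ω.W, ω.S, ω.C, X', ω.Q⟩ ?_ ?_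
  · exact (mem_support_law _ _ _ _).2 hω
  · exact (mem_support_law _ _ _ _).2 hω
  · simp [hA, hY]

/-- If for every possible query the answer together with at most `M - 1` elements of the
extension field determines the messages, then the rate is at most `(K - M + 1)⁻¹`. -/
theorem rate_le_of_determines (P : Protocol K M F E) (hM : 1 ≤ M) (hMK : M ≤ K)
    (h : ∀ q ∈ ((P.law hM hMK).map fun ω => ω.Q).support, ∃ (ι : Type) (_ : Fintype ι)
      (R : (Fin K → E) → ι → E), Fintype.card ι ≤ M - 1 ∧
        ∀ X X', P.answer q X = P.answer q X' → R X = R X' → X = X') :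
    P.rate hM hMK ≤ ((K - M + 1 : ℕ) : ℝ≥0∞)⁻¹ := by
  classical
  have : Nonempty (SupportSet K M) := supportSet_nonempty hMK
  have hE1 : 1 < Fintype.card E := Fintype.one_lt_card
  have hE : (0 : ℝ) < Fintype.card E := by exact_mod_cast (zero_lt_one.trans hE1)
  have hlog : 0 < Real.logb 2 (Fintype.card E) :=
    Real.logb_pos one_lt_two (by exact_mod_cast hE1)
  have hKM : K = (M - 1) + (K - M + 1) := by omega
  have hprob : ∀ a, (P.law hM hMK).map (fun ω => P.answer ω.Q ω.X) a ≤
      ((Fintype.card E : ℝ≥0∞) ^ (K - M + 1))⁻¹ := by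
    intro a
    rw [law]
    simp only [PMF.map_bind, PMF.map_comp]
    refine bind_apply_le _ _ _ fun S _ => bind_apply_le _ _ _ fun C _ =>
      bind_apply_le _ _ _ fun W hW => ?_
    -- Drawing the query before the messages allows it to be fixed while the messages stay uniform.
    have : ((PMF.uniformOfFintype (Fin K → E)).bind fun X => (P.query W S C).map
        ((fun ω : Outcome K M F E P.Query => P.answer ω.Q ω.X) ∘ fun Q => ⟨W, S, C, X, Q⟩)) =
        (P.query W S C).bind fun Q => (PMF.uniformOfFintype (Fin K → E)).map (P.answer Q) := by
      simp only [PMF.map, Function.comp_def]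
      rw [PMF.bind_comm]
    rw [this]
    refine bind_apply_le _ _ _ fun Q hQ => ?_
    obtain ⟨ι, _, R, hι, hR⟩ := h Q ((PMF.mem_support_map_iff _ _ _).2
      ⟨⟨W, S, C, 0, Q⟩, (mem_support_law _ _ _ _).2
        ⟨(PMF.mem_support_uniformOfFinset_iff _ _).1 hW, hQ⟩, rfl⟩)
    have hcard : (Finset.univ.filter fun X => P.answer Q X = a).card ≤
        Fintype.card E ^ (M - 1) := by
      calc (Finset.univ.filter fun X => P.answer Q X = a).card
          ≤ (Finset.univ : Finset (ι → E)).card := by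
            refine Finset.card_le_card_of_injOn R (fun _ _ => Finset.mem_univ _) ?_
            intro X hX X' hX' he
            simp only [Finset.coe_filter, Finset.mem_univ, true_and, Set.mem_ofPred_eq] at hX hX'
            exact hR X X' (hX.trans hX'.symm) he
        _ = Fintype.card E ^ Fintype.card ι := by rw [Finset.card_univ, Fintype.card_fun]
        _ ≤ _ := Nat.pow_le_pow_right (zero_lt_one.trans hE1) hι
    have hE0 : (Fintype.card E : ℝ≥0∞) ≠ 0 := by exact_mod_cast (zero_lt_one.trans hE1).ne'
    rw [uniformOfFintype_map_apply, Fintype.card_fun, Fintype.card_fin]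
    calc _ ≤ ((Fintype.card E : ℝ≥0∞) ^ (M - 1)) * ((Fintype.card E ^ K : ℕ) : ℝ≥0∞)⁻¹ := by
          gcongr
          exact_mod_cast hcard
      _ = _ := by
          conv_lhs => rw [hKM]
          rw [Nat.cast_pow, pow_add, ENNReal.mul_inv (Or.inl (pow_ne_zero _ hE0)) (Or.inl (by simp)),
            ← mul_assoc, ENNReal.mul_inv_cancel (pow_ne_zero _ hE0) (by simp), one_mul]
  have hent := ofReal_logb_le_entropy ((P.law hM hMK).map fun ω => P.answer ω.Q ω.X)
    (N := (Fintype.card E : ℝ) ^ (K - M + 1)) (by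
      intro a
      have := ENNReal.toReal_mono (by simp) (hprob a)
      simpa using this)
  rw [rate, finrank_mul_logb_card]
  rw [Real.logb_pow, ENNReal.ofReal_mul (by positivity), ENNReal.ofReal_natCast] at hent
  calc _ ≤ ENNReal.ofReal (Real.logb 2 (Fintype.card E)) /
        (((K - M + 1 : ℕ) : ℝ≥0∞) * ENNReal.ofReal (Real.logb 2 (Fintype.card E))) :=
        ENNReal.div_le_div_left hent _
    _ = _ := by
      have h0 : ENNReal.ofReal (Real.logb 2 (Fintype.card E)) ≠ 0 := by
        simpa using hlog
      rw [div_eq_mul_inv, ENNReal.mul_inv (Or.inl (by simp)) (Or.inl (by simp)), mul_comm,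
        mul_assoc, ENNReal.inv_mul_cancel h0 (by simp), mul_one]

end Protocol

/-! ### Side information as a linear combination -/

section SideInfo

variable {K M : ℕ} {F E : Type} [Field F] [Field E] [Algebra F E]

/-- The coefficients of the side information, extended by zero to all message indices. -/
def coeffVec (S : SupportSet K M) (C : Coeffs M F) (i : Fin K) : F :=
  if h : i ∈ S.1 then C ((S.1.orderIsoOfFin S.2).symm ⟨i, h⟩) else 0

theorem coeffVec_of_mem {S : SupportSet K M} (C : Coeffs M F) {i : Fin K} (h : i ∈ S.1) :
    coeffVec S C i = C ((S.1.orderIsoOfFin S.2).symm ⟨i, h⟩) := dif_pos h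

theorem coeffVec_ne_zero {S : SupportSet K M} (C : Coeffs M F) {i : Fin K} (h : i ∈ S.1) :
    coeffVec S C i ≠ 0 := by
  rw [coeffVec_of_mem C h]
  exact Units.ne_zero _

theorem coeffVec_of_notMem {S : SupportSet K M} (C : Coeffs M F) {i : Fin K} (h : i ∉ S.1) :
    coeffVec S C i = 0 := dif_neg h

theorem coeffVec_orderIsoOfFin (S : SupportSet K M) (C : Coeffs M F) (j : Fin M) :
    coeffVec S C (S.1.orderIsoOfFin S.2 j) = C j := by
  rw [coeffVec_of_mem C (Subtype.coe_prop _)]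
  simp only [Subtype.coe_eta, OrderIso.symm_apply_apply]

theorem sideInfo_eq_linComb (S : SupportSet K M) (C : Coeffs M F) (X : Fin K → E) :
    sideInfo S C X = linComb (coeffVec S C) X := by
  rw [linComb, sideInfo, ← Finset.sum_subset (Finset.subset_univ S.1)
    (fun i _ hi => by rw [coeffVec_of_notMem C hi, zero_smul]),
    ← Finset.sum_coe_sort S.1, ← (S.1.orderIsoOfFin S.2).toEquiv.sum_comp]
  refine Finset.sum_congr rfl fun j _ => ?_
  rw [RelIso.coe_fn_toEquiv, coeffVec_orderIsoOfFin, Finset.coe_orderIsoOfFin_apply]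

/-- The side information and all but one of the messages in its support determine the
remaining one. -/
theorem eq_of_sideInfo_eq {S : SupportSet K M} {C : Coeffs M F} {X X' : Fin K → E}
    (h : sideInfo S C X = sideInfo S C X') {i : Fin K} (hi : i ∈ S.1)
    (hne : ∀ k ∈ S.1, k ≠ i → X k = X' k) : X i = X' i := by
  rw [sideInfo_eq_linComb, sideInfo_eq_linComb, linComb, linComb,
    ← Finset.add_sum_erase _ _ (Finset.mem_univ i),
    ← Finset.add_sum_erase _ _ (Finset.mem_univ i)] at h
  rw [Finset.sum_congr rfl (g := fun k => coeffVec S C k • X' k)] at h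
  · exact smul_right_injective E (coeffVec_ne_zero C hi) (add_right_cancel h)
  · intro k hk
    by_cases hkS : k ∈ S.1
    · rw [hne k hkS (Finset.ne_of_mem_erase hk)]
    · rw [coeffVec_of_notMem C hkS, zero_smul, zero_smul]

/-- The linear combination with given coefficients, as a linear map in the coefficients. -/
def linCombLin (E : Type) [Field E] [Algebra F E] (X : Fin K → E) : (Fin K → F) →ₗ[F] E :=
  Fintype.linearCombination F X

theorem linCombLin_apply (X : Fin K → E) (g : Fin K → F) : linCombLin E X g = linComb g X := rfl

theorem linComb_sub_right (g : Fin K → F) (X X' : Fin K → E) :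
    linComb g (X - X') = linComb g X - linComb g X' := by
  simp [linComb, smul_sub]

theorem linComb_single (i : Fin K) (X : Fin K → E) :
    linComb (Pi.single i (1 : F)) X = X i := by
  simp [linComb, Pi.single_apply, ite_smul]

/-- Vectors supported in a set of coordinates. -/
def supportedIn (F : Type) [Field F] {K : ℕ} (J : Finset (Fin K)) : Submodule F (Fin K → F) where
  carrier := {v | ∀ i ∉ J, v i = 0}
  add_mem' ha hb i hi := by simp [ha i hi, hb i hi]
  zero_mem' _ _ := rfl
  smul_mem' c v hv i hi := by simp [hv i hi]

/-- A maximal set of coordinates on which a subspace has no nonzero supported vector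
complements this subspace. -/
theorem exists_supportedIn_compl (V : Submodule F (Fin K → F)) :
    ∃ J : Finset (Fin K), V ⊓ supportedIn F J = ⊥ ∧
      ∀ i, (Pi.single i 1 : Fin K → F) ∈ V ⊔ supportedIn F J := by
  classical
  obtain ⟨J, hJ⟩ := (Set.toFinite {J : Finset (Fin K) | V ⊓ supportedIn F J = ⊥}).exists_maximal
    ⟨∅, by
      rw [Set.mem_ofPred_eq, eq_bot_iff]
      rintro v ⟨-, hv⟩
      exact funext fun i => hv i (by simp)⟩
  refine ⟨J, hJ.prop, fun i => ?_⟩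
  by_cases hi : i ∈ J
  · refine Submodule.mem_sup_right fun k hk => ?_
    rw [Pi.single_apply, if_neg]
    rintro rfl
    exact hk hi
  -- Maximality of `J` gives a nonzero `v ∈ V` supported in `insert i J`; then `v i ≠ 0`, and the
  -- unit vector at `i` differs from a multiple of `v` by a vector supported in `J`.
  have hne : V ⊓ supportedIn F (insert i J) ≠ ⊥ := fun h =>
    hi (hJ.le_of_ge (y := insert i J) h (Finset.subset_insert i J) (Finset.mem_insert_self i J))
  obtain ⟨v, ⟨hvV, hvJ⟩, hv0⟩ := Submodule.exists_mem_ne_zero_of_ne_bot hne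
  have hvi : v i ≠ 0 := by
    intro h
    apply hv0
    rw [← Submodule.mem_bot F, ← hJ.prop]
    refine ⟨hvV, fun k hk => ?_⟩
    by_cases hki : k = i
    · rw [hki, h]
    · exact hvJ k (by simp [hki, hk])
  have hdec : (Pi.single i 1 : Fin K → F) =
      (v i)⁻¹ • v + (Pi.single i 1 - (v i)⁻¹ • v) := by abel
  rw [hdec]
  refine Submodule.add_mem_sup (V.smul_mem _ hvV) fun k hk => ?_
  by_cases hki : k = i
  · subst hki
    simp [hvi]
  · simp [hki, hvJ k (by simp [hki, hk])]

/-- If the linear combinations of the messages with coefficients in a subspace determine a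
message, then the subspace contains the corresponding unit vector. -/
theorem single_mem_of_determines (V : Submodule F (Fin K → F)) (W : Fin K)
    (h : ∀ X : Fin K → E, (∀ g ∈ V, linComb g X = 0) → X W = 0) :
    (Pi.single W 1 : Fin K → F) ∈ V := by
  classical
  by_contra hW
  -- The values on unit vectors of a functional killing `V` but not the unit vector at `W` form a
  -- message vector violating `h`.
  obtain ⟨f, hf, hle⟩ := Submodule.exists_le_ker_of_notMem hW
  have hX : ∀ g : Fin K → F,
      linComb g (fun i => algebraMap F E (f (Pi.single i 1))) = algebraMap F E (f g) := by
    intro g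
    rw [LinearMap.pi_apply_eq_sum_univ f g, map_sum, linComb]
    refine Finset.sum_congr rfl fun i _ => ?_
    rw [Algebra.smul_def, smul_eq_mul, map_mul]
    congr 3
    ext k
    simp [Pi.single_apply, eq_comm]
  have := h (fun i => algebraMap F E (f (Pi.single i 1))) fun g hg => by
    rw [hX, LinearMap.mem_ker.1 (hle hg), map_zero]
  exact hf (by simpa using this)

end SideInfo

/-! ### Converse bounds on the rate -/

namespace Protocol

variable {K M : ℕ} {F E : Type} [Field F] [Fintype F] [DecidableEq F] [Field E] [Fintype E]
  [Algebra F E]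

/-- With `n = K - M + 1`, the hypothesis gives `2 * n ≤ K`. The side information of a support `S i`
is used twice: with the answer it yields message `i`, and once the rest of the support is known it
yields message `n + i`. -/
theorem rate_le_of_two_mul_le (P : Protocol K M F E) {hM : 1 ≤ M} {hMK : M ≤ K}
    (h2 : K + 2 ≤ 2 * M) (hp : P.IsPrivate hM hMK) (hr : P.IsRecoverable hM hMK) :
    P.rate hM hMK ≤ ((K - M + 1 : ℕ) : ℝ≥0∞)⁻¹ := by
  refine rate_le_of_determines P hM hMK fun q hq => ?_
  obtain ⟨n, hn⟩ : ∃ n, n = K - M + 1 := ⟨_, rfl⟩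
  -- The indices strictly between `n + i` and `2 * n` number at most `n - 1 = K - M`, so avoiding
  -- them leaves room for `M` elements.
  have hS : ∀ i : Fin n, ∃ S : SupportSet K M, (⟨i, by omega⟩ : Fin K) ∈ S.1 ∧
      (⟨n + i, by omega⟩ : Fin K) ∈ S.1 ∧ ∀ k ∈ S.1, k.1 ≤ n + i ∨ 2 * n ≤ k.1 := by
    intro i
    let T : Finset (Fin K) := Finset.univ.filter fun k => n + i < k.1 ∧ k.1 < 2 * n
    have hTmem : ∀ k : Fin K, k ∈ T ↔ n + i < k.1 ∧ k.1 < 2 * n := fun k => by simp [T]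
    have hT : T.card ≤ n - 1 := by
      calc T.card ≤ (Finset.Ioo (n + i.1) (2 * n)).card :=
            Finset.card_le_card_of_injOn Fin.val
              (fun k hk => Finset.mem_coe.2 (Finset.mem_Ioo.2 ((hTmem k).1 hk)))
              (Fin.val_injective.injOn)
        _ ≤ n - 1 := by
            rw [Nat.card_Ioo]
            omega
    obtain ⟨S, hS1, hS2, hS3⟩ := Finset.exists_subsuperset_card_eq
      (s := {(⟨i, by omega⟩ : Fin K), ⟨n + i, by omega⟩}) (t := Tᶜ) (n := M) (by
        intro k hk
        rw [Finset.mem_compl, hTmem]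
        simp only [Finset.mem_insert, Finset.mem_singleton, Fin.ext_iff] at hk
        omega) (Finset.card_le_two.trans (by omega)) (by
        rw [Finset.card_compl, Fintype.card_fin]
        omega)
    refine ⟨⟨S, hS3⟩, hS1 (by simp), hS1 (by simp), fun k hk => ?_⟩
    have := hS2 hk
    rw [Finset.mem_compl, hTmem] at this
    omega
  choose S hSl hSr hSk using hS
  choose C hC using fun i => exists_coeffs_decodable hp hr hq (hSl i)
  let J : Type := {j : Fin K // 2 * n ≤ j.1}
  have hJ : Fintype.card J ≤ K - 2 * n := by
    rw [← Fintype.card_fin (K - 2 * n)]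
    refine Fintype.card_le_of_injective
      (fun j : J => (⟨j.1.1 - 2 * n, by have := j.1.2; have := j.2; omega⟩ : Fin (K - 2 * n))) ?_
    intro a b hab
    simp only [Fin.mk.injEq] at hab
    have := a.2
    have := b.2
    exact Subtype.ext (Fin.ext (by omega))
  -- The count is `n + (K - 2 * n) = K - n = M - 1`.
  refine ⟨Fin n ⊕ J, inferInstance, fun X => Sum.elim (fun i => sideInfo (S i) (C i) X)
    fun j => X j.1, ?_, fun X X' hA hR => ?_⟩
  · rw [Fintype.card_sum, Fintype.card_fin]
    omega
  have hY : ∀ i, sideInfo (S i) (C i) X = sideInfo (S i) (C i) X' := fun i =>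
    congrFun hR (Sum.inl i)
  have hZ : ∀ k : Fin K, 2 * n ≤ k.1 → X k = X' k := fun k hk => congrFun hR (Sum.inr ⟨k, hk⟩)
  have hlow : ∀ k : Fin K, k.1 < n → X k = X' k := fun k hk => hC ⟨k, hk⟩ X X' hA (hY ⟨k, hk⟩)
  have hmid : ∀ i (hi : i < n), X ⟨n + i, by omega⟩ = X' ⟨n + i, by omega⟩ := by
    intro i
    induction i using Nat.strong_induction_on with
    | _ i ih =>
      intro hi
      refine eq_of_sideInfo_eq (hY ⟨i, hi⟩) (hSr ⟨i, hi⟩) fun k hk hne => ?_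
      rcases hSk ⟨i, hi⟩ k hk with h | h
      · by_cases hkn : k.1 < n
        · exact hlow k hkn
        · have hk' : k = ⟨n + (k.1 - n), by omega⟩ := Fin.ext (by simp only; omega)
          rw [Ne, Fin.ext_iff] at hne
          simp only at hne h
          rw [hk']
          exact ih _ (by omega) (by omega)
      · exact hZ k h
  funext k
  by_cases h1 : k.1 < n
  · exact hlow k h1
  by_cases h3 : 2 * n ≤ k.1
  · exact hZ k h3
  have hk' : k = ⟨n + (k.1 - n), by omega⟩ := Fin.ext (by simp only; omega)
  rw [hk']
  exact hmid _ (by omega)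

theorem rate_le_of_isScalarLinear (P : Protocol K M F E) {hM : 1 ≤ M} {hMK : M ≤ K}
    (hM2 : 2 ≤ M) (hl : P.IsScalarLinear) (hp : P.IsPrivate hM hMK)
    (hr : P.IsRecoverable hM hMK) : P.rate hM hMK ≤ ((K - M + 1 : ℕ) : ℝ≥0∞)⁻¹ := by
  classical
  refine rate_le_of_determines P hM hMK fun q hq => ?_
  obtain ⟨e, he⟩ := hl
  obtain ⟨G, hG⟩ := he q
  have hans : ∀ X X', P.answer q X = P.answer q X' ↔ ∀ g ∈ G, linComb g X = linComb g X' := by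
    intro X X'
    rw [← e.injective.eq_iff, hG, hG, List.map_inj_left]
  obtain ⟨J, hJ0, hJ⟩ := exists_supportedIn_compl (Submodule.span F {g | g ∈ G})
  have hvanish : ∀ X : Fin K → E, (∀ g ∈ G, linComb g X = 0) →
      Submodule.span F {g | g ∈ G} ≤ LinearMap.ker (linCombLin E X) := fun X hX =>
    Submodule.span_le.2 fun g hg => hX g hg
  refine ⟨J, inferInstance, fun X j => X j.1, ?_, fun X X' hA hR => ?_⟩
  · rw [Fintype.card_coe]
    by_contra hcard
    obtain ⟨S, hSJ, hSM⟩ := Finset.exists_subset_card_eq (s := J) (n := M) (by omega)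
    -- The second index `W'`, available since `2 ≤ M`, later forces the multiple of the side
    -- information vector to vanish.
    obtain ⟨W, hW, W', hW', hne⟩ := Finset.one_lt_card.1 (by omega : 1 < S.card)
    obtain ⟨C, hC⟩ := exists_coeffs_decodable hp hr hq (S := ⟨S, hSM⟩) hW
    have hmem := single_mem_of_determines (E := E)
      (Submodule.span F {g | g ∈ G} ⊔ Submodule.span F {coeffVec ⟨S, hSM⟩ C}) W (by
        intro X hX
        -- By linearity it suffices to compare with the zero messages.
        refine hC X 0 ((hans X 0).2 fun g hg => ?_) ?_
        · rw [hX g (Submodule.mem_sup_left (Submodule.subset_span hg))]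
          simp [linComb]
        · rw [sideInfo_eq_linComb, hX _ (Submodule.mem_sup_right
            (Submodule.mem_span_singleton_self _))]
          simp [sideInfo])
    obtain ⟨v, hv, w, hw, hvw⟩ := Submodule.mem_sup.1 hmem
    obtain ⟨c, rfl⟩ := Submodule.mem_span_singleton.1 hw
    have hv' : v = Pi.single W 1 - c • coeffVec ⟨S, hSM⟩ C := eq_sub_of_add_eq hvw
    have hv0 : v = 0 := by
      rw [← Submodule.mem_bot F, ← hJ0]
      refine ⟨hv, fun i hi => ?_⟩
      have hiS : i ∉ S := fun h => hi (hSJ h)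
      have hiW : i ≠ W := fun h => hiS (h ▸ hW)
      rw [hv']
      simp [hiW, coeffVec_of_notMem (S := ⟨S, hSM⟩) C hiS]
    rw [hv0] at hv'
    have h1 := congrFun hv' W'
    have h3 := congrFun hv' W
    simp only [Pi.zero_apply, Pi.sub_apply, Pi.smul_apply, smul_eq_mul, Pi.single_apply,
      if_neg hne.symm, zero_sub, if_true] at h1 h3
    have hc : c = 0 := by
      rcases mul_eq_zero.1 (neg_eq_zero.1 h1.symm) with h | h
      · exact h
      · exact absurd h (coeffVec_ne_zero (S := ⟨S, hSM⟩) C hW')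
    rw [hc] at h3
    simp at h3
  · have hker := hvanish (X - X') fun g hg => by
      rw [linComb_sub_right, (hans X X').1 hA g hg, sub_self]
    have hJker : supportedIn F J ≤ LinearMap.ker (linCombLin E (X - X')) := by
      intro v hv
      rw [LinearMap.mem_ker, linCombLin_apply, linComb]
      refine Finset.sum_eq_zero fun i _ => ?_
      by_cases hi : i ∈ J
      · have := congrFun hR ⟨i, hi⟩
        simp only at this
        rw [Pi.sub_apply, this, sub_self, smul_zero]
      · rw [hv i hi, zero_smul]
    funext i
    have := sup_le hker hJker (hJ i)
    rw [LinearMap.mem_ker, linCombLin_apply, linComb_single] at this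
    exact sub_eq_zero.1 this

end Protocol

/-! ### Codewords of a Reed-Solomon code with prescribed support -/

section ReedSolomon

variable {K M : ℕ} {F : Type} [Field F]

/-- The monic polynomial vanishing exactly at the evaluation points outside a set. -/
def vanishingPoly (x : Fin K → F) (S : Finset (Fin K)) : Polynomial F :=
  ∏ j ∈ Sᶜ, (Polynomial.X - Polynomial.C (x j))

theorem natDegree_vanishingPoly (x : Fin K → F) (S : SupportSet K M) :
    (vanishingPoly x S.1).natDegree = K - M := by
  rw [vanishingPoly, Polynomial.natDegree_prod_of_monic _ _ fun j _ => Polynomial.monic_X_sub_C _]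
  simp [Finset.card_compl, S.2]

theorem eval_vanishingPoly_of_notMem (x : Fin K → F) {S : Finset (Fin K)} {i : Fin K}
    (hi : i ∉ S) : (vanishingPoly x S).eval (x i) = 0 := by
  rw [vanishingPoly, Polynomial.eval_prod]
  exact Finset.prod_eq_zero (Finset.mem_compl.2 hi) (by simp)

theorem eval_vanishingPoly_ne_zero {x : Fin K → F} (hx : Function.Injective x)
    {S : Finset (Fin K)} {i : Fin K} (hi : i ∈ S) : (vanishingPoly x S).eval (x i) ≠ 0 := by
  rw [vanishingPoly, Polynomial.eval_prod, Finset.prod_ne_zero_iff]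
  intro j hj
  rw [Polynomial.eval_sub, Polynomial.eval_X, Polynomial.eval_C, sub_ne_zero]
  intro h
  exact Finset.mem_compl.1 hj (hx h ▸ hi)

/-- The factors carrying the side information coefficients to the column multipliers. -/
def multiplier (x : Fin K → F) (hx : Function.Injective x) (W : Fin K) (S : SupportSet K M)
    (i : Fin K) : Fˣ :=
  if hi : i ∈ S.1 then
    (if i = W then -1 else 1) * (Units.mk0 _ (eval_vanishingPoly_ne_zero hx hi))⁻¹
  else 1

/-- The column multipliers are in bijection with the pairs of side information coefficients
and arbitrary nonzero elements at the indices outside the support set. -/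
def multiplierEquiv (x : Fin K → F) (hx : Function.Injective x) (W : Fin K)
    (S : SupportSet K M) : Coeffs M F × ({i // i ∉ S.1} → Fˣ) ≃ (Fin K → Fˣ) :=
  ((Equiv.arrowCongr (S.1.orderIsoOfFin S.2).toEquiv (Equiv.refl Fˣ)).prodCongr
    (Equiv.refl _)).trans
    ((Equiv.piEquivPiSubtypeProd (· ∈ S.1) fun _ => Fˣ).symm.trans
      (Equiv.mulRight (multiplier x hx W S)))

/-- The sign flip at `W` is what makes decoding possible: without it the codeword would reproduce
the side information and reveal nothing new. -/
theorem multiplierEquiv_apply_of_mem (x : Fin K → F) (hx : Function.Injective x) (W : Fin K)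
    (S : SupportSet K M) (C : Coeffs M F) (u : {i // i ∉ S.1} → Fˣ) {i : Fin K} (hi : i ∈ S.1) :
    (multiplierEquiv x hx W S (C, u) i : F) * (vanishingPoly x S.1).eval (x i) =
      (if i = W then -1 else 1) * coeffVec S C i := by
  have h0 := eval_vanishingPoly_ne_zero hx hi
  rw [coeffVec_of_mem C hi]
  simp [multiplierEquiv, multiplier, hi, Equiv.piEquivPiSubtypeProd, Equiv.arrowCongr]
  split_ifs <;> simp [h0]

end ReedSolomon

/-! ### The Reed-Solomon scheme -/

section Scheme

variable (K M : ℕ) {F : Type} [Field F] [Fintype F] [DecidableEq F]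

/-- The protocol whose answers are the inner products of the messages with the rows of a
randomly scaled Reed-Solomon generator matrix of dimension `K - M + 1`. -/
def reedSolomonProtocol (x : Fin K → F) (hx : Function.Injective x) : Protocol K M F F where
  Query := Fin K → Fˣ
  Answer := Fin (K - M + 1) → F
  query W S C := (PMF.uniformOfFintype ({i // i ∉ S.1} → Fˣ)).map fun u =>
    multiplierEquiv x hx W S (C, u)
  answer v X t := linComb (fun i => (v i : F) * x i ^ (t : ℕ)) X

variable {K M} (x : Fin K → F) (hx : Function.Injective x)

theorem reedSolomonProtocol_isScalarLinear :
    (reedSolomonProtocol K M x hx).IsScalarLinear :=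
  ⟨⟨fun a => List.ofFn a, List.ofFn_injective⟩, fun v =>
    ⟨List.ofFn fun t : Fin (K - M + 1) => fun i => (v i : F) * x i ^ (t : ℕ), fun X => by
      rw [List.map_ofFn]
      rfl⟩⟩

/-- For fixed `(W, S)` the bijection `multiplierEquiv` carries the uniform pair `(C, u)` to uniform
multipliers. -/
theorem reedSolomonProtocol_isPrivate (hM : 1 ≤ M) (hMK : M ≤ K) :
    (reedSolomonProtocol K M x hx).IsPrivate hM hMK :=
  Protocol.isPrivate_of_bind_query_eq _ hM hMK (PMF.uniformOfFintype (Fin K → Fˣ)) fun W S =>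
    uniformOfFintype_bind_map_equiv (multiplierEquiv x hx W S)

/-- The answer determines every combination of the messages given by a scaled codeword. -/
theorem sum_coeff_mul_answer (v : Fin K → Fˣ) (X : Fin K → F) (f : Polynomial F)
    (hf : f.natDegree < K - M + 1) :
    ∑ t : Fin (K - M + 1), f.coeff t * (reedSolomonProtocol K M x hx).answer v X t =
      linComb (fun i => (v i : F) * f.eval (x i)) X := by
  simp only [reedSolomonProtocol, linComb, smul_eq_mul, Finset.mul_sum]
  rw [Finset.sum_comm]
  refine Finset.sum_congr rfl fun i _ => ?_
  rw [Polynomial.eval_eq_sum_range' hf, ← Fin.sum_univ_eq_sum_range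
    (fun t => f.coeff t * x i ^ t), Finset.mul_sum, Finset.sum_mul]
  exact Finset.sum_congr rfl fun t _ => by ring

/-- The codeword of `vanishingPoly`, of degree `K - M`, is the side information vector with `2 c_W`
subtracted at `W`; since `2 c_W ≠ 0`, answer and side information fix `X W`. -/
theorem reedSolomonProtocol_isRecoverable (hM : 1 ≤ M) (hMK : M ≤ K) (h2 : (2 : F) ≠ 0) :
    (reedSolomonProtocol K M x hx).IsRecoverable hM hMK := by
  rw [Protocol.IsRecoverable, condEntropy_eq_zero_iff]
  rintro ⟨W, S, C, X, v⟩ hω ⟨W', S', C', X', v'⟩ - h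
  simp only [Prod.mk.injEq] at h
  obtain ⟨hA, rfl, hY, rfl, rfl, rfl⟩ := h
  obtain ⟨hW, hQ⟩ := (Protocol.mem_support_law _ _ _ _).1 hω
  simp only at hW hQ
  obtain ⟨u, -, hu⟩ := (PMF.mem_support_map_iff _ _ _).1 hQ
  have hv : ∀ i, (v i : F) * (vanishingPoly x S.1).eval (x i) =
      coeffVec S C i - (if i = W then 2 * coeffVec S C W else 0) := by
    intro i
    by_cases hi : i ∈ S.1
    · rw [← hu, multiplierEquiv_apply_of_mem x hx W S C u hi]
      split_ifs with hiW
      · rw [hiW]; ring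
      · ring
    · have hiW : i ≠ W := fun h => hi (h ▸ hW)
      rw [eval_vanishingPoly_of_notMem x hi, coeffVec_of_notMem C hi, if_neg hiW]
      ring
  have key : ∀ Z : Fin K → F, ∑ t : Fin (K - M + 1), (vanishingPoly x S.1).coeff t *
      (reedSolomonProtocol K M x hx).answer v Z t =
        sideInfo S C Z - 2 * coeffVec S C W * Z W := by
    intro Z
    rw [sum_coeff_mul_answer x hx v Z _ (by rw [natDegree_vanishingPoly]; omega),
      sideInfo_eq_linComb]
    simp only [linComb, hv, smul_eq_mul, sub_mul, Finset.sum_sub_distrib]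
    simp [ite_mul]
  have h1 := key X
  rw [hA, key X', hY] at h1
  exact (mul_left_cancel₀ (mul_ne_zero h2 (coeffVec_ne_zero C hW)) (sub_right_injective h1)).symm

theorem le_rate_reedSolomonProtocol (hM : 1 ≤ M) (hMK : M ≤ K) :
    ((K - M + 1 : ℕ) : ℝ≥0∞)⁻¹ ≤ (reedSolomonProtocol K M x hx).rate hM hMK := by
  have hlog : 0 < Real.logb 2 (Fintype.card F) :=
    Real.logb_pos one_lt_two (by exact_mod_cast Fintype.one_lt_card)
  have h0 : ENNReal.ofReal (Real.logb 2 (Fintype.card F)) ≠ 0 := by simpa using hlog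
  have hent : entropy (((reedSolomonProtocol K M x hx).law hM hMK).map fun ω =>
      (reedSolomonProtocol K M x hx).answer ω.Q ω.X) ≤
      ((K - M + 1 : ℕ) : ℝ≥0∞) * ENNReal.ofReal (Real.logb 2 (Fintype.card F)) := by
    refine (entropy_le_ofReal_logb_card (α := Fin (K - M + 1) → F) _).trans (le_of_eq ?_)
    rw [Fintype.card_fun, Fintype.card_fin, Nat.cast_pow, Real.logb_pow,
      ENNReal.ofReal_mul (by positivity), ENNReal.ofReal_natCast]
  rw [Protocol.rate, finrank_mul_logb_card]
  refine le_trans (le_of_eq ?_) (ENNReal.div_le_div_left hent _)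
  rw [div_eq_mul_inv, ENNReal.mul_inv (Or.inl (by simp)) (Or.inl (by simp)), mul_comm,
    mul_assoc, ENNReal.inv_mul_cancel h0 (by simp), mul_one]

end Scheme

/-! ### Capacity bounds and conclusion -/

theorem scalarLinearCapacity_le_capacity (K M : ℕ) (hM : 1 ≤ M) (hMK : M ≤ K) :
    scalarLinearCapacity K M hM hMK ≤ capacity K M hM hMK := by
  refine sSup_le_sSup ?_
  rintro r ⟨F, E, i1, i2, i3, i4, i5, i6, P, -, h⟩
  exact ⟨F, E, i1, i2, i3, i4, i5, i6, P, h⟩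

theorem le_scalarLinearCapacity (K M : ℕ) (hM : 1 ≤ M) (hMK : M ≤ K) :
    ((K - M + 1 : ℕ) : ℝ≥0∞)⁻¹ ≤ scalarLinearCapacity K M hM hMK := by
  -- A prime `p ≥ K + 3` provides `K` distinct evaluation points and makes 2 nonzero; the extension
  -- degree is 1.
  obtain ⟨p, hp, hprime⟩ := Nat.exists_infinite_primes (K + 3)
  have : Fact p.Prime := ⟨hprime⟩
  have hcast : ∀ a b : ℕ, a < p → b < p → (a : ZMod p) = b → a = b := fun a b ha hb h => by
    have := (ZMod.natCast_eq_natCast_iff' a b p).1 h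
    rwa [Nat.mod_eq_of_lt ha, Nat.mod_eq_of_lt hb] at this
  have hx : Function.Injective fun i : Fin K => (i.1 : ZMod p) := fun i j h =>
    Fin.ext (hcast _ _ (by omega) (by omega) h)
  have h2 : (2 : ZMod p) ≠ 0 := fun h => by
    have := hcast 2 0 (by omega) (by omega) (by exact_mod_cast h)
    omega
  exact (le_rate_reedSolomonProtocol _ hx hM hMK).trans (le_sSup
    ⟨ZMod p, ZMod p, inferInstance, inferInstance, inferInstance, inferInstance, inferInstance,
      inferInstance, reedSolomonProtocol K M _ hx, reedSolomonProtocol_isScalarLinear _ hx,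
      reedSolomonProtocol_isPrivate _ hx hM hMK, reedSolomonProtocol_isRecoverable _ hx hM hMK h2,
      rfl⟩)

theorem scalarLinearCapacity_le {K M : ℕ} (hM : 2 ≤ M) (hMK : M ≤ K) :
    scalarLinearCapacity K M (one_le_two.trans hM) hMK ≤ ((K - M + 1 : ℕ) : ℝ≥0∞)⁻¹ := by
  refine sSup_le ?_
  rintro r ⟨F, E, _, _, _, _, _, _, P, hl, hp, hr, rfl⟩
  exact P.rate_le_of_isScalarLinear hM hl hp hr

theorem capacity_le {K M : ℕ} (hM : 1 ≤ M) (hMK : M ≤ K) (h : K + 2 ≤ 2 * M) :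
    capacity K M hM hMK ≤ ((K - M + 1 : ℕ) : ℝ≥0∞)⁻¹ := by
  refine sSup_le ?_
  rintro r ⟨F, E, _, _, _, _, _, _, P, hp, hr, rfl⟩
  exact P.rate_le_of_two_mul_le h hp hr

end PIR

end

theorem theorem2 (K M : ℕ) (hM : 2 ≤ M) (hMK : M ≤ K) :
    ((((K : ℝ) + 1) / 2 < (M : ℝ) →
        PIR.capacity K M (one_le_two.trans hM) hMK = (((K - M + 1 : ℕ) : ENNReal))⁻¹) ∧
      ((M : ℝ) ≤ ((K : ℝ) + 1) / 2 →
        (((K - M + 1 : ℕ) : ENNReal))⁻¹ ≤ PIR.capacity K M (one_le_two.trans hM) hMK)) ∧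
    PIR.scalarLinearCapacity K M (one_le_two.trans hM) hMK =
      (((K - M + 1 : ℕ) : ENNReal))⁻¹ := by
  have hlin := PIR.le_scalarLinearCapacity K M (one_le_two.trans hM) hMK
  have hcap := hlin.trans (PIR.scalarLinearCapacity_le_capacity K M (one_le_two.trans hM) hMK)
  refine ⟨⟨fun h => (PIR.capacity_le _ hMK ?_).antisymm hcap, fun _ => hcap⟩,
    (PIR.scalarLinearCapacity_le hM hMK).antisymm hlin⟩
  have : (K : ℝ) + 1 < 2 * M := by linarith
  have : K + 1 < 2 * M := by exact_mod_cast this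
  omega
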